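/- **Conventions.** A quiver is a finite directed graph; a *rooted tree quiver* $(Q,\sigma)$ is a quiver whose underlying undirected graph is a tree and which has a unique sink $\sigma$, its root. A map of quivers sends vertices to vertices and arrows to arrows, preserving heads and tails. A *quiver over $Q$* is a quiver $Q'$ with a map of quivers $f\colon Q'\to Q$ (not required to preserve roots), and a morphism of quivers over $Q$ is a map of quivers commuting with the structure maps to $Q$. For a poset $A$ let $J(A)$ be the set of order ideals (down-closed subsets) of $A$, ordered by inclusion. For each vertex $x$ of a rooted tree quiver $Q$ define recursively the finite poset $$L_{Q,x}=\prod_{a\colon y\to x}J(L_{Q,y}),$$ the product being over all arrows $a$ of $Q$ with head $x$ ($y$ is the tail of $a$), with the componentwise order; it has one element if there is no such arrow. Let $L_Q=\coprod_x L_{Q,x}$. For $M=(M_a)_a\in L_{Q,x}$ the *reduced quiver* $c_M\colon Q_M\to Q$ is defined recursively: $Q_M$ has a root $\sigma_M$ with $c_M(\sigma_M)=x$ and, for each arrow $a\colon y\to x$ and each maximal element $S$ of the ideal $M_a\subseteq L_{Q,y}$, a separate copy of $Q_S$ (mapped to $Q$ by $c_S$) together with one arrow, mapped to $a$, from the root $\sigma_S$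 of this copy to $\sigma_M$. A quiver $f\colon Q'\to Q$ over $Q$ is *rank equivalent* to $Q_M$ if there are morphisms $Q_M\xrightarrow{g}Q'\xrightarrow{h}Q_M$ of quivers over $Q$ with $h\circ g=\mathrm{id}$. For a field $K$, let $\mathrm{Rep}_K(Q)$ be the category of finite dimensional representations of $Q$ over $K$. For a representation $V$ of a connected quiver $Q'$, let $E(V)\subseteq V$ be the largest subrepresentation all of whose arrow maps are surjective and $V\twoheadrightarrow I(V)$ the largest quotient all of whose arrow maps are injective. The *global rank functor* $\mathrm{rank}_{Q'}$ sends $V$ to the vector space at a vertex of $Q'$ of the image of $E(V)\hookrightarrow V\twoheadrightarrow I(V)$; up to isomorphism it does not depend on the vertex. For $f\colon Q'\to Q$, $f^*\colon \mathrm{Rep}_K(Q)\to\mathrm{Rep}_K(Q')$ is pullback, $(f^*V)_x=V_{f(x)}$, $(f^*V)_a=V_{f(a)}$. **Theorem.** Let $(Q,\sigma)$ be a rooted tree quiver. 1. For every rooted tree quiver $(Q',\sigma')$ and every map of quivers $f\colon Q'\to Q$ there exists $M\in L_Q$ such that $f\colon Q'\to Q$ is rank equivalent to $Q_M$. 2.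 Consequently, for every field $K$, the functors $\mathrm{rank}_{Q'}\circ f^*$ from $\mathrm{Rep}_K(Q)$ to finite dimensional $K$-vector spaces, where $f\colon Q'\to Q$ runs over all rooted tree quivers over $Q$, form only finitely many isomorphism classes of functors. -/

import Mathlib

open CategoryTheory

universe k w u v u' v' u'' v''

namespace RankQuiver

/-! ### Rooted tree quivers

A quiver is a Mathlib `Quiver`: a type of vertices, and for each ordered pair of vertices `x`, `y`
the type `x ⟶ y` of arrows with tail `x` and head `y`.  A map of directed graphs is a Mathlib
`Prefunctor`, written `Q' ⥤q Q`; composition of such maps is `⋙q`, the identity is `𝟭q`. -/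

/-- The simple graph on the vertices of `Q` in which two distinct vertices are adjacent when some
arrow, of either orientation, joins them. -/
def underlyingGraph (Q : Type u) [Quiver.{v} Q] : SimpleGraph Q :=
  SimpleGraph.fromRel fun x y => Nonempty (x ⟶ y)

/-- `Q` is a rooted tree quiver with root `σ`: it is finite, its underlying graph is a tree, and
`σ` is its unique sink.  The fields `loopless` and `injective_ends` say that the underlying
undirected multigraph of `Q` has neither loops nor multiple edges (with `Finite Q`, they also make
the set of arrows finite). -/
structure IsRootedTree (Q : Type u) [Quiver.{v} Q] (σ : Q) : Prop where
  finite : Finite Q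
  loopless : ∀ a : Quiver.Total Q, a.left ≠ a.right
  injective_ends : Function.Injective fun a : Quiver.Total Q => s(a.left, a.right)
  isTree : (underlyingGraph Q).IsTree
  sink_iff : ∀ x : Q, (∀ y : Q, IsEmpty (x ⟶ y)) ↔ x = σ

/-- `y` is the tail of an arrow with head `x`. -/
def ArrowRel (Q : Type u) [Quiver.{v} Q] (y x : Q) : Prop := Nonempty (y ⟶ x)

theorem IsRootedTree.exists_walk {Q : Type u} [Quiver.{v} Q] {σ : Q} (hQ : IsRootedTree Q σ)
    {x y : Q} (h : Relation.TransGen (ArrowRel Q) x y) :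
    ∃ p : (underlyingGraph Q).Walk x y, ¬ p.Nil ∧ p.edges.IsChain (· ≠ ·) ∧
      ∃ z, Nonempty (x ⟶ z) ∧ p.edges.head? = some s(x, z) := by
  have adj : ∀ {a b : Q}, Nonempty (a ⟶ b) → (underlyingGraph Q).Adj a b := by
    rintro a b ⟨e⟩
    exact ⟨hQ.loopless ⟨a, b, e⟩, Or.inl ⟨e⟩⟩
  induction h using Relation.TransGen.head_induction_on with
  | single h => exact ⟨.cons (adj h) .nil, by simp, by simp, _, h, by simp⟩
  | head h _ ih =>
    rename_i a c _
    obtain ⟨p, hp, hc, z, ⟨ez⟩, hz⟩ := ih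
    obtain ⟨e⟩ := h
    refine ⟨.cons (adj ⟨e⟩) p, by simp, ?_, _, ⟨e⟩, by simp⟩
    rw [SimpleGraph.Walk.edges_cons]
    cases hl : p.edges with
    | nil => simp
    | cons d l =>
      rw [hl] at hc hz
      refine List.IsChain.cons_cons ?_ hc
      simp only [List.head?_cons, Option.some.injEq] at hz
      subst hz
      intro hne
      have h1 := @hQ.injective_ends ⟨a, c, e⟩ ⟨c, z, ez⟩ hne
      exact hQ.loopless ⟨a, c, e⟩ (congrArg Quiver.Total.left h1)

/-- In a rooted tree quiver, passing from the head of an arrow to its tail is well founded; this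
justifies recursion over the vertices. -/
theorem IsRootedTree.wf {Q : Type u} [Quiver.{v} Q] {σ : Q} (hQ : IsRootedTree Q σ) :
    WellFounded (ArrowRel Q) := by
  have := hQ.finite
  have hirr : ∀ x, ¬ Relation.TransGen (ArrowRel Q) x x := by
    intro x hx
    obtain ⟨p, hp, hc, -⟩ := hQ.exists_walk hx
    have hpath := (hQ.isTree.isAcyclic.isPath_iff_isChain p).2 hc
    exact hp (SimpleGraph.Walk.isPath_iff_nil.1 hpath)
  have : Std.Irrefl (Relation.TransGen (ArrowRel Q)) := ⟨hirr⟩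
  have h := Finite.wellFounded_of_trans_of_irrefl (Relation.TransGen (ArrowRel Q))
  exact Subrelation.wf (fun h => Relation.TransGen.single h) h

/-! ### The lattices `L_{Q,x}` and the set `L_Q` -/

section Reduced

variable {Q : Type u} [Quiver.{v} Q]

/-- The poset `L_{Q,x}`, by recursion on the vertex `x`: it is the product, over all arrows
`a : y ⟶ x` with head `x`, of the posets `J(L_{Q,y})` of order ideals of `L_{Q,y}`, ordered by
inclusion (`LowerSet`).  As `L_{Q,x}` is by definition attached to the maximal subquiver with sink
`x`, and removing `x` from this subquiver leaves the maximal subquivers with sinks the tails `y` of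
these arrows, this is the recursive definition of `L_{Q,x}`. -/
def Latt (hQ : WellFounded (ArrowRel Q)) : Q → PartOrd.{max u v} :=
  hQ.fix fun x L => PartOrd.of (∀ (y : Q) (a : y ⟶ x), LowerSet (L y ⟨a⟩))

theorem latt_eq (hQ : WellFounded (ArrowRel Q)) (x : Q) :
    Latt hQ x = PartOrd.of ((y : Q) → (y ⟶ x) → LowerSet (Latt hQ y)) :=
  hQ.fix_eq _ x

/-- Equal partially ordered sets are isomorphic. -/
def orderIsoOfEq {A B : PartOrd.{w}} (h : A = B) : A ≃o B := h ▸ OrderIso.refl A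

/-- The recursion equation of `L_{Q,x}`, as an isomorphism of posets. -/
def lattIso (hQ : WellFounded (ArrowRel Q)) (x : Q) :
    Latt hQ x ≃o ((y : Q) → (y ⟶ x) → LowerSet (Latt hQ y)) :=
  orderIsoOfEq (latt_eq hQ x)

/-- The component of `M ∈ L_{Q,x}` at an arrow `a : y ⟶ x`, an order ideal of `L_{Q,y}`. -/
def comp {hQ : WellFounded (ArrowRel Q)} {x : Q} (M : Latt hQ x) {y : Q} (a : y ⟶ x) :
    LowerSet (Latt hQ y) :=
  lattIso hQ x M y a

/-- The set `L_Q`, the disjoint union of the `L_{Q,x}` over all vertices `x`. -/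
abbrev LSet (hQ : WellFounded (ArrowRel Q)) : Type (max u v) := Σ x : Q, Latt hQ x

/-! ### The reduced quivers `Q_M` -/

/-- The vertices of `Q_M` for `M ∈ L_{Q,x}`: the sink `σ_M`, and for each arrow `a : y ⟶ x` and
each maximal element `S` of the ideal `comp M a` of `L_{Q,y}`, a copy of the vertices of `Q_S`. -/
inductive RedVert (hQ : WellFounded (ArrowRel Q)) : {x : Q} → Latt hQ x → Type (max u v)
  | root {x : Q} (M : Latt hQ x) : RedVert hQ M
  | node {x : Q} (M : Latt hQ x) {y : Q} (a : y ⟶ x) (S : Latt hQ y)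
      (hS : Maximal (· ∈ comp M a) S) (p : RedVert hQ S) : RedVert hQ M

/-- The arrows of `Q_M`: for each `a` and `S` as before, an arrow over `a` from the sink of the
copy of `Q_S` to `σ_M` (so that `Q_S` is extended from its sink by one vertex, and these extensions
are glued at their sinks), and a copy of the arrows of `Q_S`. -/
inductive RedHom (hQ : WellFounded (ArrowRel Q)) :
    {x : Q} → {M : Latt hQ x} → RedVert hQ M → RedVert hQ M → Type (max u v)
  | stem {x : Q} {M : Latt hQ x} {y : Q} (a : y ⟶ x) (S : Latt hQ y)
      (hS : Maximal (· ∈ comp M a) S) :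
      RedHom hQ (RedVert.node M a S hS (RedVert.root S)) (RedVert.root M)
  | node {x : Q} {M : Latt hQ x} {y : Q} (a : y ⟶ x) (S : Latt hQ y)
      (hS : Maximal (· ∈ comp M a) S) {p q : RedVert hQ S} (f : RedHom hQ p q) :
      RedHom hQ (RedVert.node M a S hS p) (RedVert.node M a S hS q)

instance RedVert.instQuiver (hQ : WellFounded (ArrowRel Q)) {x : Q} (M : Latt hQ x) :
    Quiver.{max u v} (RedVert hQ M) where
  Hom p q := RedHom hQ p q

/-- The structure map `c_M : Q_M → Q` on vertices. -/
def redObj (hQ : WellFounded (ArrowRel Q)) : {x : Q} → {M : Latt hQ x} → RedVert hQ M → Q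
  | x, _, .root _ => x
  | _, _, .node _ _ _ _ p => redObj hQ p

/-- The structure map `c_M : Q_M → Q` on arrows. -/
def redMap (hQ : WellFounded (ArrowRel Q)) : {x : Q} → {M : Latt hQ x} → {p q : RedVert hQ M} →
    RedHom hQ p q → (redObj hQ p ⟶ redObj hQ q)
  | _, _, _, _, .stem a _ _ => a
  | _, _, _, _, .node _ _ _ f => (redMap hQ f :)

/-- The structure map `c_M : Q_M → Q` of the reduced quiver `Q_M`. -/
def redStr (hQ : WellFounded (ArrowRel Q)) {x : Q} (M : Latt hQ x) : RedVert hQ M ⥤q Q where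
  obj p := redObj hQ p
  map f := redMap hQ f

end Reduced

/-- The quivers `f : Q' → Q` and `c : R → Q` over `Q` are related by morphisms `R → Q' → R` of
quivers over `Q` (maps of directed graphs commuting with the structure maps) whose composition is
the identity of `R`.  For `c = c_M` this says that `Q'` is rank equivalent to `Q_M`. -/
def RankEquivalent {Q : Type u} [Quiver.{v} Q] {Q' : Type u'} [Quiver.{v'} Q']
    {R : Type u''} [Quiver.{v''} R] (f : Q' ⥤q Q) (c : R ⥤q Q) : Prop :=
  ∃ (g : R ⥤q Q') (h : Q' ⥤q R), g ⋙q f = c ∧ h ⋙q c = f ∧ g ⋙q h = 𝟭q R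

/-! ### Representations of quivers and global rank functors -/

/-- A representation of the quiver `Q` over the field `K`: a finite dimensional vector space at
each vertex and a linear map for each arrow. -/
structure QRep (K : Type k) [Field K] (Q : Type u) [Quiver.{v} Q] where
  obj : Q → FGModuleCat.{w} K
  map : ∀ {x y : Q}, (x ⟶ y) → (obj x →ₗ[K] obj y)

namespace QRep

variable {K : Type k} [Field K] {Q : Type u} [Quiver.{v} Q]

/-- A morphism of representations: a linear map at each vertex, commuting with the maps along
the arrows. -/
@[ext]
structure Hom (V W : QRep.{k, w} K Q) where
  app : ∀ x : Q, V.obj x →ₗ[K] W.obj x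
  comm : ∀ {x y : Q} (a : x ⟶ y), app y ∘ₗ V.map a = W.map a ∘ₗ app x

instance instCategory : Category (QRep.{k, w} K Q) where
  Hom V W := Hom V W
  id V := { app := fun _ => LinearMap.id, comm := fun _ => rfl }
  comp f g :=
    { app := fun x => g.app x ∘ₗ f.app x
      comm := fun a => by
        rw [LinearMap.comp_assoc, f.comm, ← LinearMap.comp_assoc, g.comm, LinearMap.comp_assoc] }

/-- The pullback `f^*` of representations along a map of directed graphs `f : Q' → Q`. -/
def pullback {Q' : Type u'} [Quiver.{v'} Q'] (f : Q' ⥤q Q) :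
    QRep.{k, w} K Q ⥤ QRep.{k, w} K Q' where
  obj V := { obj := fun x => V.obj (f.obj x), map := fun a => V.map (f.map a) }
  map φ := { app := fun x => φ.app (f.obj x), comm := fun a => φ.comm (f.map a) }

/-- A subrepresentation of `V`. -/
structure SubRep (V : QRep.{k, w} K Q) where
  carrier : ∀ x : Q, Submodule K (V.obj x)
  le_comap : ∀ {x y : Q} (a : x ⟶ y), carrier x ≤ (carrier y).comap (V.map a)

/-- The subrepresentation `U`, as a representation, is epimorphic: its map at every arrow is
surjective. -/
def SubRep.Epimorphic {V : QRep.{k, w} K Q} (U : SubRep V) : Prop :=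
  ∀ ⦃x y : Q⦄ (a : x ⟶ y), Function.Surjective ((V.map a).restrict (U.le_comap a))

/-- The quotient representation `V / U` is monomorphic: its map at every arrow is injective. -/
def SubRep.QuotMonomorphic {V : QRep.{k, w} K Q} (U : SubRep V) : Prop :=
  ∀ ⦃x y : Q⦄ (a : x ⟶ y),
    Function.Injective ((U.carrier x).mapQ (U.carrier y) (V.map a) (U.le_comap a))

/-- The maximal epimorphic subrepresentation of `V`: the sum of all of them. -/
def maxEpi (V : QRep.{k, w} K Q) : SubRep V where
  carrier x := ⨆ (U : SubRep V) (_ : U.Epimorphic), U.carrier x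
  le_comap a := iSup₂_le fun U hU => (U.le_comap a).trans
    (Submodule.comap_mono (le_iSup₂_of_le U hU le_rfl))

/-- The kernel of the maximal monomorphic quotient of `V`: the intersection of all
subrepresentations with monomorphic quotient. -/
def monoKer (V : QRep.{k, w} K Q) : SubRep V where
  carrier x := ⨅ (U : SubRep V) (_ : U.QuotMonomorphic), U.carrier x
  le_comap a := by
    simp only [Submodule.comap_iInf]
    exact le_iInf₂ fun U hU => (iInf₂_le U hU).trans (U.le_comap a)

theorem app_map_apply {V W : QRep.{k, w} K Q} (φ : V ⟶ W) {x y : Q} (a : x ⟶ y) (z : V.obj x) :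
    Hom.app φ y (V.map a z) = W.map a (Hom.app φ x z) :=
  LinearMap.congr_fun (Hom.comm φ a) z

/-- The image of a subrepresentation under a morphism. -/
def SubRep.image {V W : QRep.{k, w} K Q} (φ : V ⟶ W) (U : SubRep V) : SubRep W where
  carrier x := (U.carrier x).map (Hom.app φ x)
  le_comap a := by
    rintro _ ⟨z, hz, rfl⟩
    exact ⟨V.map a z, U.le_comap a hz, app_map_apply φ a z⟩

theorem SubRep.Epimorphic.image {V W : QRep.{k, w} K Q} (φ : V ⟶ W) {U : SubRep V}
    (hU : U.Epimorphic) : (U.image φ).Epimorphic := by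
  rintro x y a ⟨_, z, hz, rfl⟩
  obtain ⟨⟨t, ht⟩, hta⟩ := hU a ⟨z, hz⟩
  have hta' : V.map a t = z := congrArg Subtype.val hta
  refine ⟨⟨Hom.app φ x t, t, ht, rfl⟩, Subtype.ext ?_⟩
  change W.map a (Hom.app φ x t) = Hom.app φ y z
  rw [← hta', app_map_apply]

/-- The preimage of a subrepresentation under a morphism. -/
def SubRep.preimage {V W : QRep.{k, w} K Q} (φ : V ⟶ W) (U : SubRep W) : SubRep V where
  carrier x := (U.carrier x).comap (Hom.app φ x)
  le_comap a := by
    intro z hz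
    change Hom.app φ _ (V.map a z) ∈ U.carrier _
    rw [app_map_apply]
    exact U.le_comap a hz

theorem SubRep.quotMonomorphic_iff {V : QRep.{k, w} K Q} (U : SubRep V) :
    U.QuotMonomorphic ↔ ∀ ⦃x y : Q⦄ (a : x ⟶ y) (z : V.obj x),
      V.map a z ∈ U.carrier y → z ∈ U.carrier x := by
  refine forall_congr' fun x => forall_congr' fun y => forall_congr' fun a => ?_
  rw [← LinearMap.ker_eq_bot, Submodule.ker_mapQ, ← le_bot_iff, Submodule.map_le_iff_le_comap]
  change _ ≤ (U.carrier x).mkQ.ker ↔ _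
  rw [Submodule.ker_mkQ]
  exact Iff.rfl

theorem SubRep.QuotMonomorphic.preimage {V W : QRep.{k, w} K Q} (φ : V ⟶ W) {U : SubRep W}
    (hU : U.QuotMonomorphic) : (U.preimage φ).QuotMonomorphic := by
  rw [SubRep.quotMonomorphic_iff] at hU ⊢
  intro x y a z hz
  refine hU a _ ?_
  rw [← app_map_apply]
  exact hz

theorem maxEpi_le_comap {V W : QRep.{k, w} K Q} (φ : V ⟶ W) (x : Q) :
    V.maxEpi.carrier x ≤ (W.maxEpi.carrier x).comap (Hom.app φ x) :=
  iSup₂_le fun U hU => Submodule.map_le_iff_le_comap.1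
    (le_iSup₂_of_le (f := fun (U : SubRep W) (_ : U.Epimorphic) => U.carrier x)
      (U.image φ) (hU.image φ) le_rfl)

theorem monoKer_le_comap {V W : QRep.{k, w} K Q} (φ : V ⟶ W) (x : Q) :
    V.monoKer.carrier x ≤ (W.monoKer.carrier x).comap (Hom.app φ x) := by
  change _ ≤ Submodule.comap _ (⨅ (U : SubRep W) (_ : U.QuotMonomorphic), U.carrier x)
  simp only [Submodule.comap_iInf]
  exact le_iInf₂ fun U hU =>
    iInf₂_le_of_le (f := fun (U : SubRep V) (_ : U.QuotMonomorphic) => U.carrier x)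
      (U.preimage φ) (hU.preimage φ) le_rfl

/-- The space at the vertex `x` of the image of the composition `E ↪ V ↠ V / N`, where `E` is the
maximal epimorphic subrepresentation and `V / N` the maximal monomorphic quotient of `V`. -/
def globalSpace (V : QRep.{k, w} K Q) (x : Q) :
    Submodule K (V.obj x ⧸ V.monoKer.carrier x) :=
  (V.maxEpi.carrier x).map (V.monoKer.carrier x).mkQ

theorem mapQ_globalSpace {V W : QRep.{k, w} K Q} {x y : Q} (l : V.obj x →ₗ[K] W.obj y)
    (hE : V.maxEpi.carrier x ≤ (W.maxEpi.carrier y).comap l)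
    (hN : V.monoKer.carrier x ≤ (W.monoKer.carrier y).comap l) :
    ∀ z ∈ V.globalSpace x,
      (V.monoKer.carrier x).mapQ (W.monoKer.carrier y) l hN z ∈ W.globalSpace y := by
  rintro _ ⟨t, ht, rfl⟩
  exact ⟨l t, hE ht, by simp⟩

/-- The global tensor functor of `Q`: the image functor of the composition of the inclusion of the
maximal epimorphic subrepresentation with the projection to the maximal monomorphic quotient. -/
def globalTensor (K : Type k) [Field K] (Q : Type u) [Quiver.{v} Q] :
    QRep.{k, w} K Q ⥤ QRep.{k, w} K Q where
  obj V :=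
    { obj := fun x => FGModuleCat.of K (V.globalSpace x)
      map := fun a => ((V.monoKer.carrier _).mapQ (V.monoKer.carrier _) (V.map a)
        (V.monoKer.le_comap a)).restrict (mapQ_globalSpace (V.map a)
          (V.maxEpi.le_comap a) (V.monoKer.le_comap a)) }
  map {V W} φ :=
    { app := fun x => ((V.monoKer.carrier x).mapQ (W.monoKer.carrier x) (Hom.app φ x)
        (monoKer_le_comap φ x)).restrict (mapQ_globalSpace (Hom.app φ x)
          (maxEpi_le_comap φ x) (monoKer_le_comap φ x))
      comm := fun a => by
        ext ⟨_, t, ht, rfl⟩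
        exact congrArg (Submodule.Quotient.mk (p := W.monoKer.carrier _)) (app_map_apply φ a t) }
  map_id V := by
    refine Hom.ext (funext fun x => ?_)
    ext ⟨_, t, ht, rfl⟩
    rfl
  map_comp φ ψ := by
    refine Hom.ext (funext fun x => ?_)
    ext ⟨_, t, ht, rfl⟩
    rfl

/-- The functor `V ↦ V_x`. -/
def eval (K : Type k) [Field K] {Q : Type u} [Quiver.{v} Q] (x : Q) :
    QRep.{k, w} K Q ⥤ FGModuleCat.{w} K where
  obj V := V.obj x
  map φ := FGModuleCat.ofHom (Hom.app φ x)

/-- The global rank functor of `Q`, computed at the vertex `x`. For connected `Q` its isomorphism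
class does not depend on `x`. -/
def globalRank (K : Type k) [Field K] {Q : Type u} [Quiver.{v} Q] (x : Q) :
    QRep.{k, w} K Q ⥤ FGModuleCat.{w} K :=
  globalTensor K Q ⋙ eval K x

end QRep

end RankQuiver

/-! # Rank equivalence to reduced quivers

The reduced quivers `Q_M` are normal forms of rooted trees over `Q`.  To a vertex `z` of a tree
`f : Q' → Q` belongs an element of `L_{Q,f(z)}`, its *type* (`vertexType`): over an arrow `a` it has
the order ideal generated by the types of the tails of the arrows into `z` over `a`.  Let `M` be the
type of the root of `Q'`.  Each vertex `p` of `Q_M` also carries an element of the lattice below it,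
its `label`, and the tails of the arrows into `p` over `a` have as labels precisely the maximal
elements of the component of `label p` at `a`, each once.

Both `Q'` and `Q_M` have all arrows directed towards a root, and each vertex other than the root has
exactly one outgoing arrow, so maps out of them can be built from the root outwards, lifting one
arrow at a time (`IsInTree.exists_lift`).  The invariant "type of `z` ≤ label of the image of `z`"
gives `h : Q' → Q_M`, since every element of a finite order ideal is below a maximal one.  The
invariant "label of `p` = type of the image of `p`" gives `g : Q_M → Q'`, since a maximal element
of a generated order ideal is one of its generators.  Along `h ∘ g` labels can only grow; as the
labels of the tails over a given arrow are distinct and maximal, `h ∘ g` fixes the root and then,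
moving outwards, everything (`IsInTree.exists_morphisms`).

For the finiteness of the set of functors, the types of roots lie in the finite set `L_Q`.  Pulling
back a representation enlarges its maximal epimorphic subrepresentation and shrinks the kernel
of its maximal monomorphic quotient.  As `g` and `h` match the roots, these subspaces agree at the
roots of `Q'` and `Q_M`, and hence so do the global rank functors
(`QRep.nonempty_pullback_globalRank_iso`).  The choice of the vertex is immaterial because the maps
of the global tensor functor are bijective. -/

namespace RankQuiver

/-! ### In-trees and maps out of them -/

section InTree

variable {Q : Type u} [Quiver.{v} Q] {R : Type u'} [Quiver.{v'} R] {S : Type u''} [Quiver.{v''} S]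

/-- `R` is a possibly infinite tree with all arrows directed towards `r`: every vertex has at most
one outgoing arrow, `r` is the only vertex with none, and following the arrows from any vertex comes
to an end.  Unlike `IsRootedTree`, this speaks of arrows only, and not of the underlying graph. -/
structure IsInTree (R : Type u') [Quiver.{v'} R] (r : R) : Prop where
  subsingleton_out : ∀ x : R, Subsingleton (Σ y : R, x ⟶ y)
  wf : WellFounded fun y x : R => ArrowRel R x y
  sink_iff : ∀ x : R, (∀ y : R, IsEmpty (x ⟶ y)) ↔ x = r

theorem IsInTree.subsingleton_hom {r : R} (hR : IsInTree R r) (x y : R) :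
    Subsingleton (x ⟶ y) := by
  refine ⟨fun a b => ?_⟩
  have := (hR.subsingleton_out x).elim ⟨y, a⟩ ⟨y, b⟩
  simpa using this

/-- Induction from the root towards the leaves. -/
theorem IsInTree.induction {r : R} (hR : IsInTree R r) {P : R → Prop} (root : P r)
    (step : ∀ {x y : R} (_ : x ⟶ y), P y → P x) (x : R) : P x := by
  induction x using hR.wf.induction with
  | _ x ih =>
    by_cases hx : ∀ y : R, IsEmpty (x ⟶ y)
    · exact (hR.sink_iff x).1 hx ▸ root
    · simp only [not_forall, not_isEmpty_iff] at hx
      obtain ⟨y, ⟨a⟩⟩ := hx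
      exact step a (ih y ⟨a⟩)

theorem prefunctor_ext {F G : R ⥤q S} (h_obj : ∀ x, F.obj x = G.obj x)
    (h_map : ∀ {x y : R} (a : x ⟶ y), HEq (F.map a) (G.map a)) : F = G := by
  obtain ⟨Fo, Fm⟩ := F
  obtain ⟨Go, Gm⟩ := G
  obtain rfl : Fo = Go := funext h_obj
  congr
  funext x y a
  exact eq_of_heq (h_map a)

/-- A map of quivers over `Q` out of an in-tree can be built from the root outwards: it suffices to
have a relation between the vertices along which arrows of `R` lift to arrows of `S` with the same
image in `Q`. -/
theorem IsInTree.exists_lift {r : R} (hR : IsInTree R r) (f : R ⥤q Q) (c : S ⥤q Q)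
    (rel : R → S → Prop) (hover : ∀ {x p}, rel x p → c.obj p = f.obj x) {s : S} (hs : rel r s)
    (step : ∀ {x y : R} (a : x ⟶ y) {p : S}, rel y p →
      ∃ (q : S) (e : q ⟶ p), rel x q ∧ HEq (c.map e) (f.map a)) :
    ∃ h : R ⥤q S, h ⋙q c = f ∧ h.obj r = s ∧ ∀ x, rel x (h.obj x) := by
  classical
  let F : ∀ x : R, (∀ y : R, ArrowRel R x y → {p : S // rel y p}) → {p : S // rel x p} :=
    fun x ih =>
      if hx : Nonempty (Σ y : R, x ⟶ y) then
        ⟨(step hx.some.2 (ih hx.some.1 ⟨hx.some.2⟩).2).choose,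
          (step hx.some.2 (ih hx.some.1 ⟨hx.some.2⟩).2).choose_spec.choose_spec.1⟩
      else
        ⟨s, ((hR.sink_iff x).1 fun y => ⟨fun a => hx ⟨y, a⟩⟩) ▸ hs⟩
  let H : ∀ x : R, {p : S // rel x p} := hR.wf.fix F
  have Heq : ∀ x, H x = F x fun y _ => H y := hR.wf.fix_eq F
  have root : (H r).1 = s := by
    have hr : ¬ Nonempty (Σ y : R, r ⟶ y) := fun ⟨y, a⟩ => ((hR.sink_iff r).2 rfl y).false a
    rw [Heq]
    simp only [F, dif_neg hr]
  have arrow : ∀ {x y : R} (a : x ⟶ y),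
      ∃ e : (H x).1 ⟶ (H y).1, HEq (c.map e) (f.map a) := by
    intro x y a
    have hx : Nonempty (Σ y : R, x ⟶ y) := ⟨⟨y, a⟩⟩
    have hsome : hx.some = ⟨y, a⟩ := (hR.subsingleton_out x).elim _ _
    have hH : (H x).1 = (step a (H y).2).choose := by
      rw [Heq x]
      simp only [F, dif_pos hx]
      generalize hx.some = t at hsome
      subst hsome
      rfl
    rw [hH]
    exact ⟨_, (step a (H y).2).choose_spec.choose_spec.2⟩
  choose e he using @arrow
  exact ⟨⟨fun x => (H x).1, e⟩, prefunctor_ext (fun x => hover (H x).2) he, root, fun x => (H x).2⟩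

theorem IsRootedTree.transGen_irrefl {σ : Q} (hQ : IsRootedTree Q σ) (x : Q) :
    ¬ Relation.TransGen (ArrowRel Q) x x :=
  hQ.wf.transGen.irrefl.irrefl x

theorem IsRootedTree.wf_out {σ : Q} (hQ : IsRootedTree Q σ) :
    WellFounded fun y x : Q => ArrowRel Q x y := by
  have := hQ.finite
  have : Std.Irrefl (Relation.TransGen (Function.swap (ArrowRel Q))) :=
    ⟨fun x hx => hQ.transGen_irrefl x (Relation.transGen_swap.1 hx)⟩
  have h := Finite.wellFounded_of_trans_of_irrefl (Relation.TransGen (Function.swap (ArrowRel Q)))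
  exact h.mono fun _ _ h => .single h

theorem IsRootedTree.reflTransGen_root {σ : Q} (hQ : IsRootedTree Q σ) (x : Q) :
    Relation.ReflTransGen (ArrowRel Q) x σ := by
  induction x using hQ.wf_out.induction with
  | _ x ih =>
    by_cases hx : ∀ y : Q, IsEmpty (x ⟶ y)
    · rw [(hQ.sink_iff x).1 hx]
    · simp only [not_forall, not_isEmpty_iff] at hx
      obtain ⟨y, ha⟩ := hx
      exact .head ha (ih y ha)

/-- An arrow `x ⟶ y` starts a path in the underlying graph from `x` to the root: it is followed by
arrows towards the root, and no edge is ever repeated immediately. -/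
theorem IsRootedTree.exists_path {σ : Q} (hQ : IsRootedTree Q σ) {x y : Q} (a : x ⟶ y) :
    ∃ p : (underlyingGraph Q).Path x σ, p.1.edges.head? = some s(x, y) := by
  have adj : (underlyingGraph Q).Adj x y := ⟨hQ.loopless ⟨x, y, a⟩, Or.inl ⟨a⟩⟩
  suffices ∃ p : (underlyingGraph Q).Walk x σ, p.edges.IsChain (· ≠ ·) ∧
      p.edges.head? = some s(x, y) by
    obtain ⟨p, hp, hp'⟩ := this
    exact ⟨⟨p, (hQ.isTree.isAcyclic.isPath_iff_isChain p).2 hp⟩, hp'⟩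
  rcases Relation.reflTransGen_iff_eq_or_transGen.1 (hQ.reflTransGen_root y) with h | h
  · subst h
    exact ⟨.cons adj .nil, by simp, by simp⟩
  · obtain ⟨p, -, hc, z, ⟨b⟩, hz⟩ := hQ.exists_walk h
    refine ⟨.cons adj p, ?_, by simp⟩
    rw [SimpleGraph.Walk.edges_cons]
    cases hl : p.edges with
    | nil => simp
    | cons d l =>
      rw [hl] at hc hz
      refine List.IsChain.cons_cons ?_ hc
      simp only [List.head?_cons, Option.some.injEq] at hz
      subst hz
      intro hne
      have h1 := @hQ.injective_ends ⟨x, y, a⟩ ⟨y, z, b⟩ hne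
      exact hQ.loopless ⟨x, y, a⟩ (congrArg Quiver.Total.left h1)

theorem IsRootedTree.isInTree {σ : Q} (hQ : IsRootedTree Q σ) : IsInTree Q σ where
  subsingleton_out x := by
    refine ⟨fun ⟨y, a⟩ ⟨z, b⟩ => ?_⟩
    obtain ⟨p, hp⟩ := hQ.exists_path a
    obtain ⟨q, hq⟩ := hQ.exists_path b
    -- Paths in a tree are determined by their ends, so the two first edges agree.
    rw [(hQ.isTree.isAcyclic.subsingleton_path x σ).elim p q, hq, Option.some.injEq] at hp
    cases @hQ.injective_ends ⟨x, y, a⟩ ⟨x, z, b⟩ hp.symm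
    rfl
  wf := hQ.wf_out
  sink_iff := hQ.sink_iff

theorem IsRootedTree.finite_hom {σ : Q} (hQ : IsRootedTree Q σ) (x y : Q) : Finite (x ⟶ y) :=
  have := hQ.isInTree.subsingleton_hom x y
  inferInstance

end InTree

/-! ### Reduced quivers and their labels -/

section Label

variable {Q : Type u} [Quiver.{v} Q]

theorem finite_latt [Finite Q] [∀ x y : Q, Finite (x ⟶ y)] (hQ : WellFounded (ArrowRel Q)) (x : Q) :
    Finite (Latt hQ x) := by
  induction x using hQ.induction with
  | _ x ih =>
    have hfin (y : Q) (a : y ⟶ x) : Finite (LowerSet (Latt hQ y)) :=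
      have := ih y ⟨a⟩
      Finite.of_injective _ (SetLike.coe_injective (A := LowerSet (Latt hQ y)))
    have (y : Q) : Finite ((y ⟶ x) → LowerSet (Latt hQ y)) :=
      @Pi.finite _ _ _ fun a => hfin y a
    exact Finite.of_equiv _ (lattIso hQ x).symm.toEquiv

variable {hQ : WellFounded (ArrowRel Q)}

theorem comp_lattIso_symm {x : Q} (I : (y : Q) → (y ⟶ x) → LowerSet (Latt hQ y)) {y : Q}
    (a : y ⟶ x) : comp ((lattIso hQ x).symm I) a = I y a := by
  simp [comp]

theorem comp_mono {x : Q} {M N : Latt hQ x} (h : M ≤ N) {y : Q} (a : y ⟶ x) :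
    comp M a ≤ comp N a :=
  (lattIso hQ x).monotone h y a

/-- The element `S ∈ L_{Q,y}` such that the subquiver of `Q_M` with sink `p` over `y` is a copy
of `Q_S`. -/
def label : {x : Q} → {M : Latt hQ x} → (p : RedVert hQ M) → Latt hQ (redObj hQ p)
  | _, M, .root _ => M
  | _, _, .node _ _ _ _ p => label p

/-- `label p` together with the vertex of `Q` below `p`.  Since `LSet hQ` carries the sum order,
in which elements over different vertices are incomparable, (in)equalities of such pairs record
equality of the vertices as well. -/
def labelPair {x : Q} {M : Latt hQ x} (p : RedVert hQ M) : LSet hQ := ⟨redObj hQ p, label p⟩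

theorem maximal_label {x : Q} {M : Latt hQ x} {p q : RedVert hQ M} (e : RedHom hQ q p) :
    Maximal (· ∈ comp (label p) (redMap hQ e)) (label q) := by
  induction e with
  | stem a S hS => exact hS
  | node a S hS f ih => exact ih

theorem exists_arrow_of_maximal {x : Q} {M : Latt hQ x} (p : RedVert hQ M) {y : Q}
    (a : y ⟶ redObj hQ p) {S : Latt hQ y} (hS : Maximal (· ∈ comp (label p) a) S) :
    ∃ (q : RedVert hQ M) (e : q ⟶ p), HEq (redMap hQ e) a ∧ labelPair q = ⟨y, S⟩ := by
  induction p with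
  | root M => exact ⟨.node M a S hS (.root S), .stem a S hS, .rfl, rfl⟩
  | node M b T hT p ih =>
    obtain ⟨q, e, he, hl⟩ := ih a hS
    exact ⟨.node M b T hT q, .node b T hT e, he, hl⟩

/-- The arrows of `Q_M` with a given head are determined by their image in `Q` and the label of
their tail. -/
theorem eq_of_labelPair_eq {x : Q} {M : Latt hQ x} {p q q' : RedVert hQ M} (e : RedHom hQ q p)
    (e' : RedHom hQ q' p) (he : HEq (redMap hQ e) (redMap hQ e')) (hl : labelPair q = labelPair q') :
    q = q' := by
  induction e with
  | stem a S hS =>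
    cases e' with
    | stem a' S' hS' =>
      cases hl
      cases he
      rfl
  | node a S hS f ih =>
    cases e' with
    | node _ _ _ f' => rw [ih f' he hl]

/-- The number of arrows on the path from a vertex of `Q_M` to the root. -/
def depth : {x : Q} → {M : Latt hQ x} → RedVert hQ M → ℕ
  | _, _, .root _ => 0
  | _, _, .node _ _ _ _ p => depth p + 1

theorem depth_eq {x : Q} {M : Latt hQ x} {p q : RedVert hQ M} (e : RedHom hQ q p) :
    depth q = depth p + 1 := by
  induction e with
  | stem a S hS => rfl
  | node a S hS f ih => exact congrArg (· + 1) ih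

theorem isInTree_redVert {x : Q} (M : Latt hQ x) : IsInTree (RedVert hQ M) (.root M) where
  subsingleton_out p := by
    induction p with
    | root M => exact ⟨fun ⟨_, e⟩ => nomatch e⟩
    | node M a S hS p ih =>
      refine ⟨fun ⟨q, (e : RedHom hQ _ q)⟩ ⟨q', (e' : RedHom hQ _ q')⟩ => ?_⟩
      cases e with
      | stem =>
        cases e' with
        | stem => rfl
        | node _ _ _ f' => nomatch f'
      | node _ _ _ f =>
        cases e' with
        | stem => nomatch f
        | node _ _ _ f' =>
          cases ih.elim ⟨_, f⟩ ⟨_, f'⟩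
          rfl
  wf := Subrelation.wf (r := InvImage (· < ·) depth)
    (fun {q p} ⟨e⟩ => by simp [InvImage, depth_eq e]) (InvImage.wf _ wellFounded_lt)
  sink_iff p := by
    refine ⟨fun h => ?_, ?_⟩
    · induction p with
      | root M => rfl
      | node M a S hS p ih =>
        refine absurd (ih fun q => ⟨fun e => (h _).false (.node a S hS e)⟩) ?_
        rintro rfl
        exact (h _).false (.stem a S hS)
    · rintro rfl q
      exact ⟨fun e => nomatch e⟩

/-- Comparison in `LSet hQ` restricts to components. -/
theorem exists_mem_comp_of_le {N N' : LSet hQ} (h : N ≤ N') {y : Q} (a : y ⟶ N.1) {S : Latt hQ y}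
    (hS : S ∈ comp N.2 a) : ∃ a' : y ⟶ N'.1, HEq a' a ∧ S ∈ comp N'.2 a' := by
  obtain ⟨x, M, M', h⟩ := h
  exact ⟨a, .rfl, comp_mono h a hS⟩

theorem eq_of_maximal_of_le {x : Q} {M : Latt hQ x} {N N' : LSet hQ} {a : N.1 ⟶ x}
    {a' : N'.1 ⟶ x} (ha : HEq a a') (hN : Maximal (· ∈ comp M a) N.2) (hN' : N'.2 ∈ comp M a')
    (h : N ≤ N') : N = N' := by
  obtain ⟨y, S, S', h⟩ := h
  cases ha
  have hS : S = S' := hN.eq_of_le hN' h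
  rw [hS]

end Label

/-! ### The reduced quiver of a tree over `Q` -/

section TypeOf

variable {Q : Type u} [Quiver.{v} Q] {R : Type u'} [Quiver.{v'} R]

theorem wf_of_prefunctor (hQ : WellFounded (ArrowRel Q)) (f : R ⥤q Q) :
    WellFounded (ArrowRel R) :=
  Subrelation.wf (r := InvImage (ArrowRel Q) f.obj) (fun ⟨a⟩ => ⟨f.map a⟩) (InvImage.wf _ hQ)

/-- The element of `L_{Q,f(z)}` attached to a vertex `z` of a quiver `f : R → Q` over `Q`: its
component at an arrow `a : y ⟶ f(z)` is the order ideal generated by the elements attached to the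
tails `t` of the arrows `t ⟶ z` over `a`.  As `f(t) = y` need not hold by definition, elements of
the ideal are compared as elements of `LSet hQ`. -/
noncomputable def vertexType (hQ : WellFounded (ArrowRel Q)) (f : R ⥤q Q) :
    (z : R) → Latt hQ (f.obj z) :=
  (wf_of_prefunctor hQ f).fix fun z T => (lattIso hQ (f.obj z)).symm fun y a =>
    { carrier := {S | ∃ (t : R) (b : t ⟶ z), HEq (f.map b) a ∧
        (⟨y, S⟩ : LSet hQ) ≤ ⟨f.obj t, T t ⟨b⟩⟩}
      lower' := fun _ _ h ⟨t, b, hb, hS⟩ => ⟨t, b, hb, le_trans (Sigma.LE.fiber _ _ _ h) hS⟩ }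

/-- `vertexType` together with the vertex of `Q`, as for `labelPair`. -/
noncomputable def vertexTypePair (hQ : WellFounded (ArrowRel Q)) (f : R ⥤q Q) (z : R) : LSet hQ :=
  ⟨f.obj z, vertexType hQ f z⟩

theorem mem_comp_vertexType (hQ : WellFounded (ArrowRel Q)) (f : R ⥤q Q) (z : R) {y : Q}
    (a : y ⟶ f.obj z) (S : Latt hQ y) : S ∈ comp (vertexType hQ f z) a ↔
      ∃ (t : R) (b : t ⟶ z), HEq (f.map b) a ∧ (⟨y, S⟩ : LSet hQ) ≤ vertexTypePair hQ f t := by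
  rw [vertexType, WellFounded.fix_eq, comp_lattIso_symm]
  exact Iff.rfl

/-- Arrows of `R` can be lifted to any reduced quiver whose labels dominate the vertex types. -/
theorem exists_arrow_of_vertexTypePair_le {hQ : WellFounded (ArrowRel Q)}
    [∀ y, Finite (Latt hQ y)] (f : R ⥤q Q) {x : Q} {M : Latt hQ x} {t z : R} (b : t ⟶ z)
    {p : RedVert hQ M} (h : vertexTypePair hQ f z ≤ labelPair p) :
    ∃ (q : RedVert hQ M) (e : q ⟶ p), vertexTypePair hQ f t ≤ labelPair q ∧
      HEq ((redStr hQ M).map e) (f.map b) := by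
  obtain ⟨a, ha, hmem⟩ := exists_mem_comp_of_le h (f.map b)
    ((mem_comp_vertexType hQ f z (f.map b) (vertexType hQ f t)).2 ⟨t, b, .rfl, le_rfl⟩)
  obtain ⟨S, hle, hS⟩ := Finite.exists_le_maximal (p := (· ∈ comp (label p) a)) hmem
  obtain ⟨q, e, he, hl⟩ := exists_arrow_of_maximal p a hS
  exact ⟨q, e, hl ▸ Sigma.LE.fiber _ _ _ hle, he.trans ha⟩

/-- Arrows of a reduced quiver can be lifted to `R` along equality of labels and vertex types: a
maximal element of an order ideal is one of the generators. -/
theorem exists_arrow_of_vertexTypePair_eq {hQ : WellFounded (ArrowRel Q)} (f : R ⥤q Q) {x : Q}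
    {M : Latt hQ x} {p q : RedVert hQ M} (e : q ⟶ p) {z : R}
    (h : vertexTypePair hQ f z = labelPair p) :
    ∃ (t : R) (b : t ⟶ z), vertexTypePair hQ f t = labelPair q ∧
      HEq (f.map b) ((redStr hQ M).map e) := by
  have key : ∀ {N : LSet hQ}, N = labelPair p → ∃ a : redObj hQ q ⟶ N.1,
      HEq a (redMap hQ e) ∧ Maximal (· ∈ comp N.2 a) (label q) := by
    rintro _ rfl
    exact ⟨redMap hQ e, .rfl, maximal_label e⟩
  obtain ⟨a, ha, hmax⟩ := key h
  obtain ⟨t, b, hb, hle⟩ := (mem_comp_vertexType hQ f z a _).1 hmax.prop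
  refine ⟨t, b, ?_, hb.trans ha⟩
  exact (eq_of_maximal_of_le hb.symm hmax
    ((mem_comp_vertexType hQ f z (f.map b) _).2 ⟨t, b, .rfl, le_rfl⟩) hle).symm

/-- An in-tree over `Q` is rank equivalent to the reduced quiver of the type of its root, through
morphisms that match the roots. -/
theorem IsInTree.exists_morphisms {hQ : WellFounded (ArrowRel Q)} [∀ y, Finite (Latt hQ y)]
    {r : R} (hR : IsInTree R r) (f : R ⥤q Q) :
    ∃ (g : RedVert hQ (vertexType hQ f r) ⥤q R) (h : R ⥤q RedVert hQ (vertexType hQ f r)),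
      g ⋙q f = redStr hQ _ ∧ h ⋙q redStr hQ _ = f ∧ g ⋙q h = 𝟭q _ ∧
        g.obj (.root _) = r ∧ h.obj r = .root _ := by
  have hM := isInTree_redVert (vertexType hQ f r)
  obtain ⟨h, hc, hr, hrel⟩ := hR.exists_lift f (redStr hQ (vertexType hQ f r))
    (fun z p => vertexTypePair hQ f z ≤ labelPair p)
    (fun {z p} hzp => by
      have : ∀ {N N' : LSet hQ}, N ≤ N' → N'.1 = N.1 := by rintro _ _ ⟨⟩; rfl
      exact this hzp)
    (s := .root _) le_rfl (exists_arrow_of_vertexTypePair_le f)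
  obtain ⟨g, hf, gr, grel⟩ := hM.exists_lift (redStr hQ (vertexType hQ f r)) f
    (fun p z => vertexTypePair hQ f z = labelPair p) (fun h => congrArg Sigma.fst h)
    (s := r) rfl (exists_arrow_of_vertexTypePair_eq f)
  refine ⟨g, h, hf, hc, ?_, gr, hr⟩
  have hover : (g ⋙q h) ⋙q redStr hQ _ = redStr hQ _ := by
    rw [Prefunctor.comp_assoc, hc, hf]
  have hobj : ∀ p, (g ⋙q h).obj p = p := by
    refine hM.induction ?_ ?_
    · exact (congrArg h.obj gr).trans hr
    · intro q p e hp
      have hle : labelPair q ≤ labelPair ((g ⋙q h).obj q) := grel q ▸ hrel (g.obj q)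
      have hmap : HEq (redMap hQ ((g ⋙q h).map e)) (redMap hQ e) := by
        change HEq (((g ⋙q h) ⋙q redStr hQ _).map e) ((redStr hQ _).map e)
        rw [hover]
      -- Both labels are maximal in the same order ideal, so `labelPair q ≤ labelPair q'` is an equality.
      have key : ∀ {p' q' : RedVert hQ (vertexType hQ f r)} (e' : q' ⟶ p'), p' = p →
          HEq (redMap hQ e') (redMap hQ e) → labelPair q ≤ labelPair q' → q' = q := by
        rintro _ q' e' rfl he hle
        exact eq_of_labelPair_eq e' e he (eq_of_maximal_of_le (N := labelPair q)
          (N' := labelPair q') he.symm (maximal_label e) (maximal_label e').prop hle).symm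
      exact key _ hp hmap hle
  refine prefunctor_ext hobj fun {p q} e => ?_
  have := hM.subsingleton_hom
  have key : ∀ {p' q' : RedVert hQ (vertexType hQ f r)} (e' : p' ⟶ q'),
      p' = p → q' = q → HEq e' e := by
    rintro _ _ e' rfl rfl
    exact heq_of_eq (Subsingleton.elim _ _)
  exact key _ (hobj p) (hobj q)

end TypeOf

/-! ### Global rank functors and changes of the quiver -/

namespace QRep

variable {K : Type k} [Field K] {Q : Type u} [Quiver.{v} Q]

theorem maxEpi_epimorphic (V : QRep.{k, w} K Q) : V.maxEpi.Epimorphic := by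
  intro x y a
  suffices h : V.maxEpi.carrier y ≤ (V.maxEpi.carrier x).map (V.map a) by
    rintro ⟨z, hz⟩
    obtain ⟨t, ht, rfl⟩ := h hz
    exact ⟨⟨t, ht⟩, rfl⟩
  refine iSup₂_le fun U hU z hz => ?_
  obtain ⟨⟨t, ht⟩, hta⟩ := hU a ⟨z, hz⟩
  exact ⟨t, (le_iSup₂_of_le (f := fun (U : SubRep V) (_ : U.Epimorphic) => U.carrier x)
    U hU le_rfl) ht, congrArg Subtype.val hta⟩

theorem monoKer_quotMonomorphic (V : QRep.{k, w} K Q) : V.monoKer.QuotMonomorphic := by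
  rw [SubRep.quotMonomorphic_iff]
  intro x y a z hz
  refine Submodule.mem_iInf _ |>.2 fun U => Submodule.mem_iInf _ |>.2 fun hU => ?_
  refine U.quotMonomorphic_iff.1 hU a z ?_
  exact (iInf₂_le (f := fun (U : SubRep V) (_ : U.QuotMonomorphic) => U.carrier y) U hU) hz

/-- The maps of the global tensor functor are bijective: they are surjective because `maxEpi` is
epimorphic, and injective because the quotient by `monoKer` is monomorphic. -/
theorem bijective_globalTensor_map (V : QRep.{k, w} K Q) {x y : Q} (a : x ⟶ y) :
    Function.Bijective (((globalTensor K Q).obj V).map a) := by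
  constructor
  · intro s t h
    exact Subtype.ext (V.monoKer_quotMonomorphic a (congrArg Subtype.val h))
  · rintro ⟨_, z, hz, rfl⟩
    obtain ⟨⟨t, ht⟩, hta⟩ := V.maxEpi_epimorphic a ⟨z, hz⟩
    have hta' : V.map a t = z := congrArg Subtype.val hta
    subst hta'
    exact ⟨⟨_, t, ht, rfl⟩, rfl⟩

/-- An arrow of the quiver identifies the global rank functors at its ends. -/
theorem nonempty_globalRank_iso {x y : Q} (a : x ⟶ y) :
    Nonempty (globalRank.{k, w} K x ≅ globalRank.{k, w} K y) :=
  ⟨NatIso.ofComponents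
    (fun V => (LinearEquiv.ofBijective _ (bijective_globalTensor_map V a)).toFGModuleCatIso)
    (fun {V W} φ => by
      ext s
      exact congrFun (congrArg DFunLike.coe (Hom.comm ((globalTensor K Q).map φ) a)).symm s)⟩

section Pullback

/-- Equal pairs of submodules `E`, `N` have equal images of `E` in the quotient by `N`. -/
def mapMkQEquivOfEq {X : Type*} [AddCommGroup X] [Module K X] {E E' N N' : Submodule K X}
    (hE : E = E') (hN : N = N') : E.map N.mkQ ≃ₗ[K] E'.map N'.mkQ :=
  (Submodule.quotEquivOfEq N N' hN).ofSubmodules _ _ (by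
    subst hE hN
    rw [← Submodule.map_comp]
    rfl)

variable {R : Type u'} [Quiver.{v'} R] {S : Type u''} [Quiver.{v''} S]

theorem maxEpi_le_pullback (f : R ⥤q Q) (V : QRep.{k, w} K Q) (r : R) :
    V.maxEpi.carrier (f.obj r) ≤ ((pullback f).obj V).maxEpi.carrier r :=
  let U : SubRep ((pullback f).obj V) :=
    ⟨fun r => V.maxEpi.carrier (f.obj r), fun a => V.maxEpi.le_comap (f.map a)⟩
  le_iSup₂_of_le (f := fun (U : SubRep ((pullback f).obj V)) (_ : U.Epimorphic) => U.carrier r)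
    U (fun _ _ a => V.maxEpi_epimorphic (f.map a)) le_rfl

theorem pullback_monoKer_le (f : R ⥤q Q) (V : QRep.{k, w} K Q) (r : R) :
    ((pullback f).obj V).monoKer.carrier r ≤ V.monoKer.carrier (f.obj r) :=
  let U : SubRep ((pullback f).obj V) :=
    ⟨fun r => V.monoKer.carrier (f.obj r), fun a => V.monoKer.le_comap (f.map a)⟩
  iInf₂_le (f := fun (U : SubRep ((pullback f).obj V)) (_ : U.QuotMonomorphic) => U.carrier r)
    U (fun _ _ a => V.monoKer_quotMonomorphic (f.map a))

/-- `maxEpi_le_pullback` for a morphism `h : R → S` of quivers over `Q`, with the equalities of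
vertices and spaces relaxed. -/
theorem mem_maxEpi_of_comp_eq {h : R ⥤q S} {c : S ⥤q Q} {f : R ⥤q Q} (hc : h ⋙q c = f)
    (V : QRep.{k, w} K Q) {r : R} {s : S} (hs : h.obj r = s) {z : V.obj (c.obj s)}
    {z' : V.obj (f.obj r)} (hz : HEq z z')
    (hm : z ∈ ((pullback c).obj V).maxEpi.carrier s) :
    z' ∈ ((pullback f).obj V).maxEpi.carrier r := by
  subst hc hs
  cases hz
  exact maxEpi_le_pullback h ((pullback c).obj V) r hm

/-- `pullback_monoKer_le` in the form of `mem_maxEpi_of_comp_eq`. -/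
theorem mem_monoKer_of_comp_eq {h : R ⥤q S} {c : S ⥤q Q} {f : R ⥤q Q} (hc : h ⋙q c = f)
    (V : QRep.{k, w} K Q) {r : R} {s : S} (hs : h.obj r = s) {z : V.obj (c.obj s)}
    {z' : V.obj (f.obj r)} (hz : HEq z z')
    (hm : z' ∈ ((pullback f).obj V).monoKer.carrier r) :
    z ∈ ((pullback c).obj V).monoKer.carrier s := by
  subst hc hs
  cases hz
  exact pullback_monoKer_le h ((pullback c).obj V) r hm

/-- Two quivers over `Q` with morphisms over `Q` in both directions that match a pair of vertices
have the same global rank functor at these vertices, as the subspaces `maxEpi` and `monoKer`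
agree there. -/
theorem nonempty_pullback_globalRank_iso {f : R ⥤q Q} {c : S ⥤q Q} {g : S ⥤q R} {h : R ⥤q S}
    (hf : g ⋙q f = c) (hc : h ⋙q c = f) {s : S} {r : R} (hs : g.obj s = r) (hr : h.obj r = s) :
    Nonempty (pullback.{k, w} (K := K) f ⋙ globalRank K r ≅ pullback c ⋙ globalRank K s) := by
  subst hf hs
  have hE (V : QRep.{k, w} K Q) : ((pullback f).obj V).maxEpi.carrier (g.obj s) =
      ((pullback (g ⋙q f)).obj V).maxEpi.carrier s :=
    le_antisymm (fun _ => mem_maxEpi_of_comp_eq rfl V rfl .rfl)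
      (fun _ => mem_maxEpi_of_comp_eq hc V hr .rfl)
  have hN (V : QRep.{k, w} K Q) : ((pullback f).obj V).monoKer.carrier (g.obj s) =
      ((pullback (g ⋙q f)).obj V).monoKer.carrier s :=
    le_antisymm (fun _ => mem_monoKer_of_comp_eq hc V hr .rfl)
      (fun _ => mem_monoKer_of_comp_eq rfl V rfl .rfl)
  exact ⟨NatIso.ofComponents
    (fun V => LinearEquiv.toFGModuleCatIso (R := K)
      (V := ((pullback f).obj V).globalSpace (g.obj s))
      (W := ((pullback (g ⋙q f)).obj V).globalSpace s) (mapMkQEquivOfEq (hE V) (hN V)))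
    (fun {V W} φ => by
      ext ⟨_, t, ht, rfl⟩
      rfl)⟩

end Pullback

end QRep

theorem IsInTree.nonempty_globalRank_iso {K : Type k} [Field K] {R : Type u'} [Quiver.{v'} R]
    {r : R} (hR : IsInTree R r) (x : R) :
    Nonempty (QRep.globalRank.{k, w} K x ≅ QRep.globalRank.{k, w} K r) :=
  hR.induction (P := fun x => Nonempty (QRep.globalRank.{k, w} K x ≅ QRep.globalRank.{k, w} K r))
    ⟨Iso.refl _⟩ (fun a ⟨i⟩ => (QRep.nonempty_globalRank_iso a).map (· ≪≫ i)) x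

end RankQuiver

open CategoryTheory RankQuiver in
/-- Every rooted tree quiver over a rooted tree quiver `Q` is rank equivalent to some reduced quiver
`Q_M`, `M ∈ L_Q`; and, up to isomorphism of functors, only finitely many functors arise by pulling
back representations of `Q` to a rooted tree quiver over `Q` and applying a global rank functor. -/
theorem theorem2 {Q : Type u} [Quiver.{v} Q] {σ : Q} (hQ : IsRootedTree Q σ) :
    (∀ (Q' : Type u') [Quiver.{v'} Q'] (σ' : Q') (_ : IsRootedTree Q' σ') (f : Q' ⥤q Q),
      ∃ M : LSet hQ.wf, RankEquivalent f (redStr hQ.wf M.2)) ∧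
    ∀ (K : Type k) [Field K],
      {c : Quotient (isIsomorphicSetoid (QRep.{k, w} K Q ⥤ FGModuleCat.{w} K)) |
        ∃ (Q' : Type u') (_ : Quiver.{v'} Q') (σ' : Q') (_ : IsRootedTree Q' σ')
          (f : Q' ⥤q Q) (x : Q'),
          c = Quotient.mk _ (QRep.pullback f ⋙ QRep.globalRank K x)}.Finite := by
  have := hQ.finite
  have := hQ.finite_hom
  have := finite_latt hQ.wf
  refine ⟨fun Q' _ σ' hQ' f => ?_, fun K _ => ?_⟩
  · obtain ⟨g, h, hf, hc, hid, -⟩ := hQ'.isInTree.exists_morphisms (hQ := hQ.wf) f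
    exact ⟨⟨_, _⟩, g, h, hf, hc, hid⟩
  · refine (Set.finite_range fun M : LSet hQ.wf =>
      (Quotient.mk _ (QRep.pullback (redStr hQ.wf M.2) ⋙ QRep.globalRank K (.root M.2)) :
        Quotient (isIsomorphicSetoid (QRep.{k, w} K Q ⥤ FGModuleCat.{w} K)))).subset ?_
    rintro _ ⟨Q', _, σ', hQ', f, x, rfl⟩
    obtain ⟨g, h, hf, hc, -, hg, hh⟩ := hQ'.isInTree.exists_morphisms (hQ := hQ.wf) f
    obtain ⟨i⟩ := hQ'.isInTree.nonempty_globalRank_iso (K := K) x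
    -- `i` moves the vertex to the root, and `j` replaces `Q'` by the reduced quiver.
    obtain ⟨j⟩ := QRep.nonempty_pullback_globalRank_iso (K := K) hf hc hg hh
    exact ⟨⟨_, _⟩, Quotient.sound ⟨(Functor.isoWhiskerLeft _ i ≪≫ j).symm⟩⟩
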